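/- **Setting.** Let $A,C\in\mathbb R^{n\times n}$, $B,D\in\mathbb R^{n\times m}$, and let $Q\in\mathbb R^{n\times n}$, $R\in\mathbb R^{m\times m}$ be symmetric with $Q\succeq 0$ and $R\succ 0$. Let $(w_k)_{k\ge 0}$ be independent real random variables on a probability space with $\mathbb E\,w_k=0$ and $\mathbb E(w_kw_s)=\delta_{ks}$. A prime denotes the transpose. For $M,N\in\mathbb R^{n\times n}$ the pair $[M;N]$ is called ASMS (asymptotically mean-square stable) if for every $z\in\mathbb R^n$ the solution of $x_{k+1}=Mx_k+Nx_kw_k$, $x_0=z$, satisfies $\lim_{k\to\infty}\mathbb E\|x_k\|^2=0$. Let $$\mathscr F=\{F\in\mathbb R^{m\times n}:\ [A+BF;\,C+DF]\ \text{is ASMS}\}.$$ $(A,C|Q)$ is exactly observable (respectively exactly detectable) if there is an integer $T\ge 1$ such that for every $x_0\in\mathbb R^n$ the solution of $x_{k+1}=Ax_k+Cx_kw_k$ has the following property: if $Qx_k=0$ almost surely for $k=0,\dots,T$, then $x_0=0$ (respectively $\lim_{k\to\infty}\mathbb E\|x_k\|^2=0$). Assume that $\mathscr F\neq\emptyset$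 (the system is stabilizable) and that $(A,C|Q)$ is exactly observable or exactly detectable. Write $$A_F=\begin{bmatrix}A&B\\FA&FB\end{bmatrix},\qquad C_F=\begin{bmatrix}C&D\\FC&FD\end{bmatrix},\qquad \Lambda=\begin{bmatrix}Q&0\\0&R\end{bmatrix}.$$ **Algorithm (model-based primal-dual).** Start from some $F^0\in\mathscr F$. For $i=0,1,2,\dots$, solve $$A_{F^i}'X^iA_{F^i}+C_{F^i}'X^iC_{F^i}+\Lambda=X^i \qquad\text{(dual update)}$$ for $X^i=\begin{bmatrix}X^i_{11}&X^i_{12}\\(X^i_{12})'&X^i_{22}\end{bmatrix}\in\mathbb R^{(n+m)\times(n+m)}$, and set $$F^{i+1}=-(X^i_{22})^{-1}(X^i_{12})' \qquad\text{(primal update)}.$$ **Theorem.** The generalized algebraic Riccati equation $$A'PA+C'PC+Q-(A'PB+C'PD)(R+B'PB+D'PD)^{-1}(B'PA+D'PC)=P$$ has a unique positive semidefinite solution $P^*$, and $P^*\succ 0$ if $(A,C|Q)$ is exactly observable. For every $F^0\in\mathscr F$ the algorithm determines a unique pair of infinite sequences $(X^i)_{i\ge 0}$, $(F^i)_{i\ge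 0}$, with $F^i\in\mathscr F$, $X^i\succeq 0$ and $X^i_{22}\succ 0$ for all $i$. Moreover: 1. The algorithm coincides with the off-line policy iteration started at $F^0$: the sequences $F^i$ and $P^i:=\begin{bmatrix}I_n&(F^i)'\end{bmatrix}X^i\begin{bmatrix}I_n\\F^i\end{bmatrix}$ satisfy, and are the only sequences with initial gain $F^0$ that satisfy, for all $i\ge 0$, $$P^i=(A+BF^i)'P^i(A+BF^i)+(C+DF^i)'P^i(C+DF^i)+Q+(F^i)'RF^i,$$ $$F^{i+1}=-(R+B'P^iB+D'P^iD)^{-1}(B'P^iA+D'P^iC).$$ 2. $\lim_{i\to\infty}X^i=X^*$ and $\lim_{i\to\infty}F^i=F^*$, where the Q-function matrix $X^*$ and the gain $F^*$ are defined by $$X^*=\begin{bmatrix}Q+A'P^*A+C'P^*C&A'P^*B+C'P^*D\\B'P^*A+D'P^*C&R+B'P^*B+D'P^*D\end{bmatrix},$$ $$F^*=-(R+B'P^*B+D'P^*D)^{-1}(B'P^*A+D'P^*C).$$ -/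

import Mathlib

open Matrix MeasureTheory ProbabilityTheory Filter Topology

namespace SLQR

/-- Standing assumptions on the multiplicative noise: independent real random variables with
`E w_k = 0` and `E (w_k w_s) = δ_{ks}`. The case `k = s` of `cov` forces `w_k` to be square
integrable. -/
structure IsNoise {Ω : Type*} [MeasurableSpace Ω] (μ : Measure Ω) (w : ℕ → Ω → ℝ) : Prop where
  measurable : ∀ k, Measurable (w k)
  indep : iIndepFun w μ
  mean : ∀ k, ∫ ω, w k ω ∂μ = 0
  cov : ∀ k s, ∫ ω, w k ω * w s ω ∂μ = if k = s then 1 else 0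

/-- The solution of `x_{k+1} = A x_k + C x_k w_k`, `x_0 = z`. -/
noncomputable def state {Ω : Type*} {n : ℕ} (w : ℕ → Ω → ℝ) (A C : Matrix (Fin n) (Fin n) ℝ)
    (z : Fin n → ℝ) : ℕ → Ω → (Fin n → ℝ)
  | 0 => fun _ => z
  | k + 1 => fun ω => A *ᵥ state w A C z k ω + w k ω • (C *ᵥ state w A C z k ω)

/-- `E ‖x_k‖² → 0`, for the initial state `z`. -/
def MeanSquareToZero {Ω : Type*} [MeasurableSpace Ω] {n : ℕ} (μ : Measure Ω) (w : ℕ → Ω → ℝ)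
    (A C : Matrix (Fin n) (Fin n) ℝ) (z : Fin n → ℝ) : Prop :=
  Tendsto (fun k => ∫ ω, state w A C z k ω ⬝ᵥ state w A C z k ω ∂μ) atTop (𝓝 0)

/-- `[A; C]` is asymptotically mean-square stable. -/
def ASMS {Ω : Type*} [MeasurableSpace Ω] {n : ℕ} (μ : Measure Ω) (w : ℕ → Ω → ℝ)
    (A C : Matrix (Fin n) (Fin n) ℝ) : Prop :=
  ∀ z : Fin n → ℝ, MeanSquareToZero μ w A C z

/-- The set `𝓕` of stabilizing state-feedback gains of `[A, B; C, D]`. -/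
def stabilizingGains {Ω : Type*} [MeasurableSpace Ω] {n m : ℕ} (μ : Measure Ω) (w : ℕ → Ω → ℝ)
    (A : Matrix (Fin n) (Fin n) ℝ) (B : Matrix (Fin n) (Fin m) ℝ)
    (C : Matrix (Fin n) (Fin n) ℝ) (D : Matrix (Fin n) (Fin m) ℝ) :
    Set (Matrix (Fin m) (Fin n) ℝ) :=
  {F | ASMS μ w (A + B * F) (C + D * F)}

/-- `[A, B; C, D]` is stabilizable. -/
def Stabilizable {Ω : Type*} [MeasurableSpace Ω] {n m : ℕ} (μ : Measure Ω) (w : ℕ → Ω → ℝ)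
    (A : Matrix (Fin n) (Fin n) ℝ) (B : Matrix (Fin n) (Fin m) ℝ)
    (C : Matrix (Fin n) (Fin n) ℝ) (D : Matrix (Fin n) (Fin m) ℝ) : Prop :=
  (stabilizingGains μ w A B C D).Nonempty

/-- `(A, C | Q)` is exactly observable. -/
def ExactlyObservable {Ω : Type*} [MeasurableSpace Ω] {n : ℕ} (μ : Measure Ω) (w : ℕ → Ω → ℝ)
    (A C Q : Matrix (Fin n) (Fin n) ℝ) : Prop :=
  ∃ T : ℕ, 0 < T ∧ ∀ z : Fin n → ℝ,
    (∀ k ≤ T, ∀ᵐ ω ∂μ, Q *ᵥ state w A C z k ω = 0) → z = 0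

/-- `(A, C | Q)` is exactly detectable. -/
def ExactlyDetectable {Ω : Type*} [MeasurableSpace Ω] {n : ℕ} (μ : Measure Ω) (w : ℕ → Ω → ℝ)
    (A C Q : Matrix (Fin n) (Fin n) ℝ) : Prop :=
  ∃ T : ℕ, 0 < T ∧ ∀ z : Fin n → ℝ,
    (∀ k ≤ T, ∀ᵐ ω ∂μ, Q *ᵥ state w A C z k ω = 0) → MeanSquareToZero μ w A C z

section Matrices

variable {n m : ℕ}

/-- `P` solves the generalized algebraic Riccati equation. -/
def SolvesGARE (A : Matrix (Fin n) (Fin n) ℝ) (B : Matrix (Fin n) (Fin m) ℝ)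
    (C : Matrix (Fin n) (Fin n) ℝ) (D : Matrix (Fin n) (Fin m) ℝ)
    (Q : Matrix (Fin n) (Fin n) ℝ) (R : Matrix (Fin m) (Fin m) ℝ)
    (P : Matrix (Fin n) (Fin n) ℝ) : Prop :=
  Aᵀ * P * A + Cᵀ * P * C + Q
    - (Aᵀ * P * B + Cᵀ * P * D) * (R + Bᵀ * P * B + Dᵀ * P * D)⁻¹
      * (Bᵀ * P * A + Dᵀ * P * C) = P

/-- The gain `-(R + B'PB + D'PD)⁻¹ (B'PA + D'PC)` determined by `P`; it is `F*` for `P = P*`. -/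
noncomputable def gain (A : Matrix (Fin n) (Fin n) ℝ) (B : Matrix (Fin n) (Fin m) ℝ)
    (C : Matrix (Fin n) (Fin n) ℝ) (D : Matrix (Fin n) (Fin m) ℝ)
    (R : Matrix (Fin m) (Fin m) ℝ) (P : Matrix (Fin n) (Fin n) ℝ) :
    Matrix (Fin m) (Fin n) ℝ :=
  -((R + Bᵀ * P * B + Dᵀ * P * D)⁻¹ * (Bᵀ * P * A + Dᵀ * P * C))

/-- The Q-function matrix determined by `P`; it is `X*` for `P = P*`. -/
noncomputable def qMatrix (A : Matrix (Fin n) (Fin n) ℝ) (B : Matrix (Fin n) (Fin m) ℝ)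
    (C : Matrix (Fin n) (Fin n) ℝ) (D : Matrix (Fin n) (Fin m) ℝ)
    (Q : Matrix (Fin n) (Fin n) ℝ) (R : Matrix (Fin m) (Fin m) ℝ)
    (P : Matrix (Fin n) (Fin n) ℝ) : Matrix (Fin n ⊕ Fin m) (Fin n ⊕ Fin m) ℝ :=
  fromBlocks (Q + Aᵀ * P * A + Cᵀ * P * C) (Aᵀ * P * B + Cᵀ * P * D)
    (Bᵀ * P * A + Dᵀ * P * C) (R + Bᵀ * P * B + Dᵀ * P * D)

/-- The augmented matrix `[A B; FA FB]`; it gives both `A_F` and, from `C` and `D`, `C_F`. -/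
noncomputable def augmented (A : Matrix (Fin n) (Fin n) ℝ) (B : Matrix (Fin n) (Fin m) ℝ)
    (F : Matrix (Fin m) (Fin n) ℝ) : Matrix (Fin n ⊕ Fin m) (Fin n ⊕ Fin m) ℝ :=
  fromBlocks A B (F * A) (F * B)

/-- The weight `Λ = diag(Q, R)`. -/
def weight (Q : Matrix (Fin n) (Fin n) ℝ) (R : Matrix (Fin m) (Fin m) ℝ) :
    Matrix (Fin n ⊕ Fin m) (Fin n ⊕ Fin m) ℝ :=
  fromBlocks Q 0 0 R

/-- The sequences `X^i`, `F^i` are generated by the model-based primal-dual algorithm started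
at `F⁰`: `X^i` is a solution of the dual update equation at `F^i`, and `F^{i+1}` is obtained from
`X^i` by the primal update. -/
structure IsPrimalDual (A : Matrix (Fin n) (Fin n) ℝ) (B : Matrix (Fin n) (Fin m) ℝ)
    (C : Matrix (Fin n) (Fin n) ℝ) (D : Matrix (Fin n) (Fin m) ℝ)
    (Q : Matrix (Fin n) (Fin n) ℝ) (R : Matrix (Fin m) (Fin m) ℝ)
    (F₀ : Matrix (Fin m) (Fin n) ℝ)
    (X : ℕ → Matrix (Fin n ⊕ Fin m) (Fin n ⊕ Fin m) ℝ)
    (F : ℕ → Matrix (Fin m) (Fin n) ℝ) : Prop where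
  init : F 0 = F₀
  dual : ∀ i, (augmented A B (F i))ᵀ * X i * augmented A B (F i)
    + (augmented C D (F i))ᵀ * X i * augmented C D (F i) + weight Q R = X i
  primal : ∀ i, F (i + 1) = -((X i).toBlocks₂₂⁻¹ * (X i).toBlocks₁₂ᵀ)

/-- The sequences `P^(i)`, `F^(i)` are generated by the off-line policy iteration started at
`F⁰`. -/
structure IsPolicyIteration (A : Matrix (Fin n) (Fin n) ℝ) (B : Matrix (Fin n) (Fin m) ℝ)
    (C : Matrix (Fin n) (Fin n) ℝ) (D : Matrix (Fin n) (Fin m) ℝ)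
    (Q : Matrix (Fin n) (Fin n) ℝ) (R : Matrix (Fin m) (Fin m) ℝ)
    (F₀ : Matrix (Fin m) (Fin n) ℝ)
    (P : ℕ → Matrix (Fin n) (Fin n) ℝ) (F : ℕ → Matrix (Fin m) (Fin n) ℝ) : Prop where
  init : F 0 = F₀
  evaluation : ∀ i, P i = (A + B * F i)ᵀ * P i * (A + B * F i)
    + (C + D * F i)ᵀ * P i * (C + D * F i) + Q + (F i)ᵀ * R * F i
  improvement : ∀ i, F (i + 1) = gain A B C D R (P i)

/-- `[I F'] X [I F']'`. -/
noncomputable def compress (X : Matrix (Fin n ⊕ Fin m) (Fin n ⊕ Fin m) ℝ)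
    (F : Matrix (Fin m) (Fin n) ℝ) : Matrix (Fin n) (Fin n) ℝ :=
  (fromRows (1 : Matrix (Fin n) (Fin n) ℝ) F)ᵀ * X * fromRows (1 : Matrix (Fin n) (Fin n) ℝ) F

end Matrices

end SLQR

/-! Let `L P = M'PM + N'PN`. Since `w_k` is centred, has unit variance and is independent of `x_k`,
`E x_k'Px_k = z'(L^k P)z`, so the probability reduces to powers of a positive linear operator.
Mean-square stability makes these powers tend to zero on all matrices. Hence `P = L P + S` is
uniquely solvable and `P - L P ⪰ 0` implies `P ⪰ 0`, a comparison principle.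

The converse direction is the hard one (`asms_of_supersolution`): a solution `P ⪰ 0` of `P - L P ⪰
Q` bounds the total cost. If `E‖x_k‖²` were not summable, normalized time averages of the
second-moment matrices would have a nonzero limit of zero cost. That limit splits into rank-one
pieces, which are unobservable initial states; detectability makes them decay, whereas the averaged
second moment stays at least `1`. For a feedback `F`, zero stage cost `Q + F'RF` forces `Fx = 0`
because `R ≻ 0`, so open-loop detectability suffices.

With `X = qMatrix P`, the policy operator at `F` is `[I F']X[I F']'`. Completing the square shows
that its least value in the Loewner order is the Riccati map, attained at `gain P`. Thus the value
of a stabilizing gain is a supersolution for the improved gain, which is therefore stabilizing with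
a smaller value. The values decrease to a Riccati solution, unique by comparison. The factorization
`A_F = [I; F][A B]` identifies the dual update with policy evaluation, and transfers everything to
the primal-dual algorithm. -/

namespace SLQR

/-! ### Second moments of the state and the Lyapunov operator. -/

section Moments

variable {Ω : Type*} [MeasurableSpace Ω] {μ : Measure Ω} {w : ℕ → Ω → ℝ} {n : ℕ}

/-- The Lyapunov operator `P ↦ M'PM + N'PN`. -/
def lyapunov (M N : Matrix (Fin n) (Fin n) ℝ) :
    Module.End ℝ (Matrix (Fin n) (Fin n) ℝ) where
  toFun P := Mᵀ * P * M + Nᵀ * P * N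
  map_add' P S := by simp only [Matrix.mul_add, Matrix.add_mul]; abel
  map_smul' c P := by simp

theorem lyapunov_apply (M N P : Matrix (Fin n) (Fin n) ℝ) :
    lyapunov M N P = Mᵀ * P * M + Nᵀ * P * N := rfl

theorem IsNoise.integrable_sq (hw : IsNoise μ w) (k : ℕ) :
    Integrable (fun ω => w k ω * w k ω) μ := by
  by_contra h
  have := hw.cov k k
  rw [integral_undef h] at this
  simp at this

theorem IsNoise.integrable [IsProbabilityMeasure μ] (hw : IsNoise μ w) (k : ℕ) :
    Integrable (w k) μ := by
  refine ((hw.integrable_sq k).add (integrable_const (1 : ℝ))).mono'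
    (hw.measurable k).aestronglyMeasurable (ae_of_all _ fun ω => ?_)
  simp only [Real.norm_eq_abs, Pi.add_apply]
  rw [← abs_mul_abs_self (w k ω)]
  nlinarith [sq_nonneg (|w k ω| - 1), abs_nonneg (w k ω)]

-- Causality: `x_k` involves only the noise before time `k`, which is what makes it independent of
-- `w_k`.
omit [MeasurableSpace Ω] in
theorem exists_measurable_state_eq (w : ℕ → Ω → ℝ) (M N : Matrix (Fin n) (Fin n) ℝ)
    (z : Fin n → ℝ) (k : ℕ) :
    ∃ g : (Finset.range k → ℝ) → Fin n → ℝ, Measurable g ∧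
      ∀ ω, state w M N z k ω = g (fun i => w i ω) := by
  induction k with
  | zero => exact ⟨fun _ => z, measurable_const, fun _ => rfl⟩
  | succ k ih =>
    obtain ⟨g, hg, h⟩ := ih
    let r : (Finset.range (k + 1) → ℝ) → (Finset.range k → ℝ) := fun u i =>
      u ⟨i, Finset.mem_range.2 ((Finset.mem_range.1 i.2).trans (Nat.lt_succ_self k))⟩
    have hr : Measurable r := measurable_pi_lambda _ fun i => measurable_pi_apply _
    have hM : ∀ K : Matrix (Fin n) (Fin n) ℝ, Measurable fun v : Fin n → ℝ => K *ᵥ v :=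
      fun K => (Continuous.matrix_mulVec continuous_const continuous_id).measurable
    refine ⟨fun u => M *ᵥ g (r u) +
        u ⟨k, Finset.mem_range.2 (Nat.lt_succ_self k)⟩ • (N *ᵥ g (r u)), ?_, fun ω => ?_⟩
    · exact ((hM M).comp (hg.comp hr)).add
        ((measurable_pi_apply _).smul ((hM N).comp (hg.comp hr)))
    · simp only [state, h, r]

theorem measurable_bilin (P : Matrix (Fin n) (Fin n) ℝ) :
    Measurable fun p : (Fin n → ℝ) × (Fin n → ℝ) => p.1 ⬝ᵥ P *ᵥ p.2 :=
  (Continuous.dotProduct continuous_fst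
    (Continuous.matrix_mulVec continuous_const continuous_snd)).measurable

theorem indepFun_state_noise (hw : IsNoise μ w) (M N P : Matrix (Fin n) (Fin n) ℝ)
    (y z : Fin n → ℝ) (k : ℕ) :
    IndepFun (fun ω => state w M N y k ω ⬝ᵥ P *ᵥ state w M N z k ω) (w k) μ := by
  obtain ⟨g, hg, h⟩ := exists_measurable_state_eq w M N y k
  obtain ⟨g', hg', h'⟩ := exists_measurable_state_eq w M N z k
  have hd : Disjoint (Finset.range k) {k} := by simp
  have := hw.indep.indepFun_finset (Finset.range k) {k} hd hw.measurable
  have := this.comp ((measurable_bilin P).comp (hg.prodMk hg'))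
    (measurable_pi_apply (⟨k, Finset.mem_singleton_self k⟩ : ({k} : Finset ℕ)))
  simp_rw [h, h']
  exact this

omit [MeasurableSpace Ω] in
theorem bilin_state_succ (w : ℕ → Ω → ℝ) (M N P : Matrix (Fin n) (Fin n) ℝ)
    (y z : Fin n → ℝ) (k : ℕ) (ω : Ω) :
    state w M N y (k + 1) ω ⬝ᵥ P *ᵥ state w M N z (k + 1) ω =
      state w M N y k ω ⬝ᵥ (Mᵀ * P * M) *ᵥ state w M N z k ω
      + (state w M N y k ω ⬝ᵥ (Mᵀ * P * N + Nᵀ * P * M) *ᵥ state w M N z k ω) * w k ω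
      + (state w M N y k ω ⬝ᵥ (Nᵀ * P * N) *ᵥ state w M N z k ω) * (w k ω * w k ω) := by
  have key : ∀ (K L : Matrix (Fin n) (Fin n) ℝ) (u v : Fin n → ℝ),
      u ⬝ᵥ (Kᵀ * P * L) *ᵥ v = (K *ᵥ u) ⬝ᵥ P *ᵥ (L *ᵥ v) := by
    intro K L u v
    rw [← mulVec_mulVec, ← mulVec_mulVec, dotProduct_mulVec, vecMul_transpose]
  simp only [state, add_mulVec, dotProduct_add, key, mulVec_add, mulVec_smul, add_dotProduct,
    smul_dotProduct, dotProduct_smul, smul_eq_mul]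
  ring

/-- Independence makes each product with `w_k` or `w_k²` integrable, so second moments of the noise
suffice. The matrix is quantified inside the induction because each step changes it. -/
theorem integrable_bilin_state [IsProbabilityMeasure μ] (hw : IsNoise μ w)
    (M N : Matrix (Fin n) (Fin n) ℝ) (y z : Fin n → ℝ) (k : ℕ) :
    ∀ P : Matrix (Fin n) (Fin n) ℝ,
      Integrable (fun ω => state w M N y k ω ⬝ᵥ P *ᵥ state w M N z k ω) μ := by
  induction k with
  | zero => intro P; simp only [state]; exact integrable_const (μ := μ) _
  | succ k ih =>
    intro P
    simp_rw [bilin_state_succ]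
    refine ((ih _).add ?_).add ?_
    · exact (indepFun_state_noise hw M N _ y z k).integrable_mul (ih _) (hw.integrable k)
    · exact ((indepFun_state_noise hw M N _ y z k).comp measurable_id
        (measurable_id.mul measurable_id)).integrable_mul (ih _) (hw.integrable_sq k)

/-- After factoring by independence, the term linear in `w_k` vanishes and the quadratic one carries
the factor `E w_k² = 1`. -/
theorem integral_bilin_state_succ [IsProbabilityMeasure μ] (hw : IsNoise μ w)
    (M N P : Matrix (Fin n) (Fin n) ℝ) (y z : Fin n → ℝ) (k : ℕ) :
    ∫ ω, state w M N y (k + 1) ω ⬝ᵥ P *ᵥ state w M N z (k + 1) ω ∂μ =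
      ∫ ω, state w M N y k ω ⬝ᵥ lyapunov M N P *ᵥ state w M N z k ω ∂μ := by
  have hi := integrable_bilin_state hw M N y z k
  have h1 := indepFun_state_noise hw M N (Mᵀ * P * N + Nᵀ * P * M) y z k
  have h2 := (indepFun_state_noise hw M N (Nᵀ * P * N) y z k).comp measurable_id
    (measurable_id.mul measurable_id)
  have e1 := h1.integral_fun_mul_eq_mul_integral (hi _).aestronglyMeasurable
    (hw.integrable k).aestronglyMeasurable
  have e2 := h2.integral_fun_mul_eq_mul_integral (hi _).aestronglyMeasurable
    (hw.integrable_sq k).aestronglyMeasurable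
  have i1 := h1.integrable_mul (hi _) (hw.integrable k)
  have i2 := h2.integrable_mul (hi _) (hw.integrable_sq k)
  simp only [Function.comp_def, id_eq, Pi.mul_apply] at e2
  simp only [Function.comp_def, id_eq, Pi.mul_def] at i1 i2
  have c := hw.cov k k
  simp only [if_true] at c
  rw [hw.mean, mul_zero] at e1
  rw [c, mul_one] at e2
  simp_rw [bilin_state_succ, lyapunov_apply, add_mulVec _ _ (state _ _ _ _ _ _), dotProduct_add]
  simp_rw [add_mulVec, dotProduct_add] at e1 i1
  rw [integral_add (hi _) (hi _), integral_add (by exact (hi _).add i1) i2, integral_add (hi _) i1,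
    e1, e2, add_zero]

/-- The second moments of the state are given by the powers of the Lyapunov operator. -/
theorem integral_bilin_state [IsProbabilityMeasure μ] (hw : IsNoise μ w)
    (M N : Matrix (Fin n) (Fin n) ℝ) (y z : Fin n → ℝ) (k : ℕ) :
    ∀ P : Matrix (Fin n) (Fin n) ℝ,
      ∫ ω, state w M N y k ω ⬝ᵥ P *ᵥ state w M N z k ω ∂μ = y ⬝ᵥ (lyapunov M N ^ k) P *ᵥ z := by
  induction k with
  | zero => intro P; simp [state]
  | succ k ih =>
    intro P
    rw [integral_bilin_state_succ hw, ih, pow_succ]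
    rfl

theorem meanSquareToZero_iff [IsProbabilityMeasure μ] (hw : IsNoise μ w)
    (M N : Matrix (Fin n) (Fin n) ℝ) (z : Fin n → ℝ) :
    MeanSquareToZero μ w M N z ↔
      Tendsto (fun k => z ⬝ᵥ (lyapunov M N ^ k) 1 *ᵥ z) atTop (𝓝 0) := by
  unfold MeanSquareToZero
  simp_rw [← integral_bilin_state hw, one_mulVec]

theorem abs_bilin_le (P : Matrix (Fin n) (Fin n) ℝ) (y z : Fin n → ℝ) :
    |y ⬝ᵥ P *ᵥ z| ≤ (∑ i, ∑ j, |P i j|) * (y ⬝ᵥ y + z ⬝ᵥ z) := by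
  have hsq : ∀ (v : Fin n → ℝ) i, |v i| * |v i| ≤ v ⬝ᵥ v := fun v i => by
    rw [abs_mul_abs_self]
    exact Finset.single_le_sum (f := fun i => v i * v i)
      (fun j _ => mul_self_nonneg _) (Finset.mem_univ i)
  have hyz : ∀ i j, |y i| * |z j| ≤ y ⬝ᵥ y + z ⬝ᵥ z := fun i j => by
    nlinarith [hsq y i, hsq z j, sq_nonneg (|y i| - |z j|), abs_nonneg (y i), abs_nonneg (z j),
      mul_self_nonneg (y i), mul_self_nonneg (z j), sq_abs (y i), sq_abs (z j)]
  simp only [dotProduct, mulVec, Finset.mul_sum]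
  refine (Finset.abs_sum_le_sum_abs _ _).trans ?_
  rw [Finset.sum_mul]
  refine Finset.sum_le_sum fun i _ => (Finset.abs_sum_le_sum_abs _ _).trans ?_
  rw [Finset.sum_mul]
  refine Finset.sum_le_sum fun j _ => ?_
  rw [abs_mul, abs_mul]
  calc |y i| * (|P i j| * |z j|) = |P i j| * (|y i| * |z j|) := by ring
    _ ≤ _ := mul_le_mul_of_nonneg_left (hyz i j) (abs_nonneg _)

theorem tendsto_matrix_iff_bilin {ι : Type*} {a b : ℕ} {l : Filter ι}
    {f : ι → Matrix (Fin a) (Fin b) ℝ} {S : Matrix (Fin a) (Fin b) ℝ} :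
    Tendsto f l (𝓝 S) ↔ ∀ y z, Tendsto (fun k => y ⬝ᵥ f k *ᵥ z) l (𝓝 (y ⬝ᵥ S *ᵥ z)) := by
  constructor
  · intro h y z
    exact ((Continuous.dotProduct continuous_const
      (Continuous.matrix_mulVec continuous_id continuous_const)).tendsto S).comp h
  · intro h
    refine tendsto_pi_nhds.2 fun i => tendsto_pi_nhds.2 fun j => ?_
    simpa using h (Pi.single i 1) (Pi.single j 1)

/-- Mean-square stability makes the iterates of the Lyapunov operator vanish on all matrices,
symmetric or not. -/
theorem ASMS.tendsto_lyapunov_pow [IsProbabilityMeasure μ] (hw : IsNoise μ w)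
    {M N : Matrix (Fin n) (Fin n) ℝ} (h : ASMS μ w M N) (P : Matrix (Fin n) (Fin n) ℝ) :
    Tendsto (fun k => (lyapunov M N ^ k) P) atTop (𝓝 0) := by
  rw [tendsto_matrix_iff_bilin]
  intro y z
  simp only [zero_mulVec, dotProduct_zero]
  have hlim := ((h y).add (h z)).const_mul (∑ i, ∑ j, |P i j|)
  rw [add_zero, mul_zero] at hlim
  have hint : ∀ (x : Fin n → ℝ) k,
      Integrable (fun ω => state w M N x k ω ⬝ᵥ state w M N x k ω) μ := fun x k => by
    simpa using integrable_bilin_state hw M N x x k 1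
  refine squeeze_zero_norm (fun k => ?_) hlim
  rw [← integral_bilin_state hw, ← integral_add (hint y k) (hint z k), ← integral_const_mul]
  refine norm_integral_le_of_norm_le (((hint y k).add (hint z k)).const_mul _)
    (ae_of_all _ fun ω => ?_)
  exact abs_bilin_le _ _ _

end Moments

/-! ### Semidefinite matrices, positivity and trace duality. -/

section Semidefinite

variable {n m : ℕ}

theorem posSemidef_iff_real {P : Matrix (Fin n) (Fin n) ℝ} :
    P.PosSemidef ↔ Pᵀ = P ∧ ∀ x, 0 ≤ x ⬝ᵥ P *ᵥ x := by
  rw [posSemidef_iff_dotProduct_mulVec]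
  simp [IsHermitian, conjTranspose_eq_transpose_of_trivial]

theorem PosSemidef.transpose_mul_mul {P : Matrix (Fin n) (Fin n) ℝ} (hP : P.PosSemidef)
    (K : Matrix (Fin n) (Fin m) ℝ) : (Kᵀ * P * K).PosSemidef := by
  simpa [conjTranspose_eq_transpose_of_trivial] using hP.conjTranspose_mul_mul_same K

theorem posSemidef_of_tendsto {f : ℕ → Matrix (Fin n) (Fin n) ℝ} {P : Matrix (Fin n) (Fin n) ℝ}
    (hf : Tendsto f atTop (𝓝 P)) (h : ∀ k, (f k).PosSemidef) : P.PosSemidef := by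
  rw [posSemidef_iff_real]
  constructor
  · refine tendsto_nhds_unique ((continuous_id.matrix_transpose.tendsto P).comp hf) (hf.congr ?_)
    intro k
    exact ((posSemidef_iff_real.1 (h k)).1).symm
  · intro x
    exact ge_of_tendsto' (tendsto_matrix_iff_bilin.1 hf x x)
      fun k => (posSemidef_iff_real.1 (h k)).2 x

theorem lyapunov_posSemidef (M N : Matrix (Fin n) (Fin n) ℝ) {P : Matrix (Fin n) (Fin n) ℝ}
    (hP : P.PosSemidef) : (lyapunov M N P).PosSemidef :=
  (PosSemidef.transpose_mul_mul hP M).add (PosSemidef.transpose_mul_mul hP N)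

theorem lyapunov_pow_posSemidef (M N : Matrix (Fin n) (Fin n) ℝ) {P : Matrix (Fin n) (Fin n) ℝ}
    (hP : P.PosSemidef) (k : ℕ) : ((lyapunov M N ^ k) P).PosSemidef := by
  induction k with
  | zero => simpa
  | succ k ih =>
    rw [pow_succ']
    exact lyapunov_posSemidef M N ih

/-- The trace-adjoint `S ↦ MSM' + NSN'` propagates second-moment matrices `E x_k x_k'` forward in
time. -/
theorem trace_lyapunov_mul (M N P S : Matrix (Fin n) (Fin n) ℝ) :
    trace (lyapunov M N P * S) = trace (P * lyapunov Mᵀ Nᵀ S) := by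
  have h : ∀ K : Matrix (Fin n) (Fin n) ℝ, trace (Kᵀ * P * K * S) = trace (P * (K * S * Kᵀ)) := by
    intro K
    rw [Matrix.mul_assoc Kᵀ, Matrix.mul_assoc Kᵀ, trace_mul_comm]
    simp only [Matrix.mul_assoc]
  simp only [lyapunov_apply, Matrix.add_mul, Matrix.mul_add, trace_add, transpose_transpose, h]

theorem trace_lyapunov_pow_mul (M N : Matrix (Fin n) (Fin n) ℝ) (k : ℕ) :
    ∀ P S : Matrix (Fin n) (Fin n) ℝ,
      trace ((lyapunov M N ^ k) P * S) = trace (P * (lyapunov Mᵀ Nᵀ ^ k) S) := by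
  induction k with
  | zero => simp
  | succ k ih =>
    intro P S
    rw [pow_succ', pow_succ]
    exact (trace_lyapunov_mul M N _ S).trans (ih _ _)

theorem trace_mul_vecMulVec_self (P : Matrix (Fin n) (Fin n) ℝ) (z : Fin n → ℝ) :
    trace (P * vecMulVec z z) = z ⬝ᵥ P *ᵥ z := by
  rw [mul_vecMulVec, trace_vecMulVec, dotProduct_comm]

/-- Test the quadratic form on `e_i ± e_j`. The bound gives compactness of semidefinite matrices of
bounded trace. -/
theorem abs_apply_le_trace {S : Matrix (Fin n) (Fin n) ℝ} (hS : S.PosSemidef) (i j : Fin n) :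
    |S i j| ≤ S.trace := by
  have hd : ∀ i, S i i ≤ S.trace := fun i =>
    Finset.single_le_sum (f := fun i => S i i) (fun i _ => hS.diag_nonneg) (Finset.mem_univ i)
  obtain ⟨hsymm, hnn⟩ := posSemidef_iff_real.1 hS
  have hij : S j i = S i j := congrFun (congrFun hsymm i) j
  have h1 := hnn (Pi.single i 1 + Pi.single j 1)
  have h2 := hnn (Pi.single i 1 - Pi.single j 1)
  simp [mulVec_add, mulVec_sub, add_dotProduct, sub_dotProduct, dotProduct_add,
    dotProduct_sub, hij] at h1 h2
  have := hd i
  have := hd j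
  rw [abs_le]
  constructor <;> linarith

/-- Writing `S = Y'Y`, the vectors are the rows of `Y`. This turns a second-moment matrix back into
deterministic initial states. -/
theorem exists_sum_vecMulVec {S : Matrix (Fin n) (Fin n) ℝ} (hS : S.PosSemidef) :
    ∃ y : Fin n → Fin n → ℝ, ∀ P : Matrix (Fin n) (Fin n) ℝ,
      trace (P * S) = ∑ i, y i ⬝ᵥ P *ᵥ y i := by
  obtain ⟨Y, rfl⟩ : ∃ Y : Matrix (Fin n) (Fin n) ℝ, S = Yᵀ * Y := by
    open scoped MatrixOrder ComplexOrder in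
    obtain ⟨Y, hY⟩ := CStarAlgebra.nonneg_iff_eq_star_mul_self.1 hS.nonneg
    exact ⟨Y, by rw [hY, star_eq_conjTranspose, conjTranspose_eq_transpose_of_trivial]⟩
  refine ⟨fun i => Y i, fun P => ?_⟩
  rw [← Matrix.mul_assoc, trace_mul_comm, trace]
  refine Finset.sum_congr rfl fun i _ => ?_
  simp [Matrix.mul_apply, mulVec, dotProduct]

end Semidefinite

/-! ### Lyapunov equations and mean-square stability. -/

section Stability

variable {Ω : Type*} [MeasurableSpace Ω] {μ : Measure Ω} [IsProbabilityMeasure μ]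
  {w : ℕ → Ω → ℝ} {n : ℕ} {M N : Matrix (Fin n) (Fin n) ℝ}

/-- `P - L^k P` telescopes into a sum of semidefinite terms `L^j (P - L P)`, and `L^k P → 0`. -/
theorem ASMS.posSemidef_of_sub_lyapunov (hw : IsNoise μ w) (h : ASMS μ w M N)
    {P : Matrix (Fin n) (Fin n) ℝ} (hP : (P - lyapunov M N P).PosSemidef) : P.PosSemidef := by
  have hk : ∀ k, (P - (lyapunov M N ^ k) P).PosSemidef := by
    intro k
    induction k with
    | zero => simpa using PosSemidef.zero
    | succ k ih =>
      have := ih.add (lyapunov_pow_posSemidef M N hP k)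
      rw [map_sub] at this
      convert this using 1
      rw [pow_succ]
      simp
  refine posSemidef_of_tendsto ?_ hk
  simpa using tendsto_const_nhds.sub (h.tendsto_lyapunov_pow hw P)

theorem ASMS.lyapunov_injective (hw : IsNoise μ w) (h : ASMS μ w M N) :
    Function.Injective (1 - lyapunov M N : Module.End ℝ (Matrix (Fin n) (Fin n) ℝ)) := by
  rw [← LinearMap.ker_eq_bot, LinearMap.ker_eq_bot']
  intro P hP
  have hfix : lyapunov M N P = P :=
    (sub_eq_zero.1 (hP : P - lyapunov M N P = 0)).symm
  have hk : ∀ k, (lyapunov M N ^ k) P = P := by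
    intro k
    induction k with
    | zero => simp
    | succ k ih => rw [pow_succ', Module.End.mul_apply, ih, hfix]
  have := h.tendsto_lyapunov_pow hw P
  simp_rw [hk] at this
  exact tendsto_nhds_unique tendsto_const_nhds this

theorem ASMS.lyapunov_eq_unique (hw : IsNoise μ w) (h : ASMS μ w M N)
    {P P' S : Matrix (Fin n) (Fin n) ℝ} (hP : P = lyapunov M N P + S)
    (hP' : P' = lyapunov M N P' + S) : P = P' := by
  refine h.lyapunov_injective hw ?_
  simp only [LinearMap.sub_apply, Module.End.one_apply]
  rw [sub_eq_of_eq_add' hP, sub_eq_of_eq_add' hP']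

theorem ASMS.exists_lyapunov_eq (hw : IsNoise μ w) (h : ASMS μ w M N)
    (S : Matrix (Fin n) (Fin n) ℝ) : ∃ P, P = lyapunov M N P + S := by
  obtain ⟨P, hP⟩ := LinearMap.injective_iff_surjective.1 (h.lyapunov_injective hw) S
  refine ⟨P, ?_⟩
  rw [← hP]
  simp

theorem ae_mulVec_state_eq_zero (hw : IsNoise μ w) {Q : Matrix (Fin n) (Fin n) ℝ}
    (hQ : Q.PosSemidef) {z : Fin n → ℝ} {k : ℕ} (h : z ⬝ᵥ (lyapunov M N ^ k) Q *ᵥ z = 0) :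
    ∀ᵐ ω ∂μ, state w M N z k ω ⬝ᵥ Q *ᵥ state w M N z k ω = 0 := by
  rw [← integral_bilin_state hw, integral_eq_zero_iff_of_nonneg
    (fun ω => (posSemidef_iff_real.1 hQ).2 _) (integrable_bilin_state hw M N z z k Q)] at h
  exact h

/-- A positive semidefinite supersolution of the Lyapunov equation forces mean-square stability,
provided the unobservable initial states are stable. -/
theorem asms_of_supersolution (hw : IsNoise μ w) {P Q : Matrix (Fin n) (Fin n) ℝ}
    (hP : P.PosSemidef) (hQ : Q.PosSemidef) (hPQ : (P - lyapunov M N P - Q).PosSemidef)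
    (hdet : ∀ z, (∀ k, ∀ᵐ ω ∂μ, state w M N z k ω ⬝ᵥ Q *ᵥ state w M N z k ω = 0) →
      MeanSquareToZero μ w M N z) : ASMS μ w M N := by
  intro z
  rw [meanSquareToZero_iff hw]
  set L := lyapunov M N
  have hnn : ∀ {X : Matrix (Fin n) (Fin n) ℝ}, X.PosSemidef → ∀ x k, 0 ≤ x ⬝ᵥ (L ^ k) X *ᵥ x :=
    fun hX x k => (posSemidef_iff_real.1 (lyapunov_pow_posSemidef M N hX k)).2 x
  let a : ℕ → ℝ := fun k => z ⬝ᵥ (L ^ k) 1 *ᵥ z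
  have ha : ∀ k, 0 ≤ a k := hnn PosSemidef.one z
  -- Summability of `E‖x_k‖²` already gives decay; the rest refutes divergence of the partial sums
  -- `t k`.
  by_cases hsum : Summable a
  · exact hsum.tendsto_atTop_zero
  exfalso
  have ht := (not_summable_iff_tendsto_nat_atTop_of_nonneg ha).1 hsum
  set t : ℕ → ℝ := fun k => ∑ i ∈ Finset.range k, a i
  have ht0 : ∀ k, 0 ≤ t k := fun k => Finset.sum_nonneg fun i _ => ha i
  let S : ℕ → Matrix (Fin n) (Fin n) ℝ := fun k =>
    ∑ i ∈ Finset.range k, (lyapunov Mᵀ Nᵀ ^ i) (vecMulVec z z)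
  have hzz : (vecMulVec z z).PosSemidef := by simpa using posSemidef_vecMulVec_self_star z
  have hS : ∀ k, (S k).PosSemidef := fun k =>
    posSemidef_sum _ fun i _ => lyapunov_pow_posSemidef _ _ hzz i
  have htr : ∀ X j k, trace ((L ^ j) X * S k) =
      ∑ i ∈ Finset.range k, z ⬝ᵥ (L ^ (j + i)) X *ᵥ z := by
    intro X j k
    simp only [S, Matrix.mul_sum, trace_sum]
    refine Finset.sum_congr rfl fun i _ => ?_
    rw [← trace_lyapunov_pow_mul, trace_mul_vecMulVec_self, add_comm j i, pow_add]
    rfl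
  have htS : ∀ k, trace (S k) = t k := fun k => by
    simpa using htr 1 0 k
  -- Accumulated second moments, scaled to trace one; if `t k = 0` the inverse is `0` and the trace
  -- bound still holds.
  let U : ℕ → Matrix (Fin n) (Fin n) ℝ := fun k => (t k)⁻¹ • S k
  have hU : ∀ k, (U k).PosSemidef := fun k => (hS k).smul (inv_nonneg.2 (ht0 k))
  have hUtr : ∀ k, trace (U k) ≤ 1 := fun k => by
    simp only [U, trace_smul, htS, smul_eq_mul]
    exact inv_mul_le_one
  have hK : IsCompact (Set.pi Set.univ fun _ => Set.pi Set.univ fun _ => Set.Icc (-1) 1 :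
      Set (Fin n → Fin n → ℝ)) :=
    isCompact_univ_pi fun _ => isCompact_univ_pi fun _ => isCompact_Icc
  obtain ⟨V, φ, hφ, hV⟩ : ∃ (V : Matrix (Fin n) (Fin n) ℝ) (φ : ℕ → ℕ), StrictMono φ ∧
      Tendsto (fun k => U (φ k)) atTop (𝓝 V) := by
    obtain ⟨V, -, φ, hφ, hV⟩ := hK.tendsto_subseq (x := show ℕ → Fin n → Fin n → ℝ from U)
      fun k i _ j _ => abs_le.1 ((abs_apply_le_trace (hU k) i j).trans (hUtr k))
    exact ⟨V, φ, hφ, hV⟩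
  have hVpsd : V.PosSemidef := posSemidef_of_tendsto hV fun k => hU _
  have htφ : Tendsto (fun k => (t (φ k))⁻¹) atTop (𝓝 0) :=
    tendsto_inv_atTop_zero.comp (ht.comp hφ.tendsto_atTop)
  have hlim : ∀ X : Matrix (Fin n) (Fin n) ℝ,
      Tendsto (fun k => (t (φ k))⁻¹ * trace (X * S (φ k))) atTop (𝓝 (trace (X * V))) := by
    intro X
    have : Continuous fun Y : Matrix (Fin n) (Fin n) ℝ => trace (X * Y) := by fun_prop
    refine ((this.tendsto V).comp hV).congr fun k => ?_
    simp [U, trace_smul]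
  -- Shifting the averaging window by `j` loses at most the fixed amount `t j`, negligible against
  -- `t (φ k) → ∞`.
  have hone : ∀ j, 1 ≤ trace ((L ^ j) 1 * V) := by
    intro j
    have hl : Tendsto (fun k => 1 - (t (φ k))⁻¹ * t j) atTop (𝓝 1) := by
      simpa using tendsto_const_nhds.sub (htφ.mul_const (t j))
    refine le_of_tendsto_of_tendsto hl (hlim _) ?_
    filter_upwards [(ht.comp hφ.tendsto_atTop).eventually_gt_atTop 0] with k hk
    simp only [Function.comp] at hk
    have h1 : t (φ k) ≤ t (j + φ k) :=
      Finset.sum_le_sum_of_subset_of_nonneg (by gcongr; omega) fun i _ _ => ha i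
    have h2 : t (j + φ k) = t j + ∑ i ∈ Finset.range (φ k), a (j + i) := Finset.sum_range_add _ _ _
    rw [htr]
    have h3 : (t (φ k))⁻¹ * (t (φ k) - t j) ≤
        (t (φ k))⁻¹ * ∑ i ∈ Finset.range (φ k), a (j + i) :=
      mul_le_mul_of_nonneg_left (by linarith) (inv_nonneg.2 hk.le)
    rwa [mul_sub, inv_mul_cancel₀ hk.ne'] at h3
  -- The supersolution inequality telescopes: the cost accumulated from time `j` on is at most
  -- `z'(L^j P)z`, and the normalization sends it to zero.
  have hzero : ∀ j, trace ((L ^ j) Q * V) ≤ 0 := by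
    intro j
    have hl : Tendsto (fun k => (t (φ k))⁻¹ * (z ⬝ᵥ (L ^ j) P *ᵥ z)) atTop (𝓝 0) := by
      simpa using htφ.mul_const (z ⬝ᵥ (L ^ j) P *ᵥ z)
    refine le_of_tendsto_of_tendsto' (hlim _) hl fun k => ?_
    refine mul_le_mul_of_nonneg_left ?_ (inv_nonneg.2 (ht0 _))
    rw [htr]
    have hstep : ∀ i, z ⬝ᵥ (L ^ (j + i)) Q *ᵥ z ≤
        z ⬝ᵥ (L ^ (j + i)) P *ᵥ z - z ⬝ᵥ (L ^ (j + (i + 1))) P *ᵥ z := by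
      intro i
      have := hnn hPQ z (j + i)
      rw [map_sub, map_sub, ← Module.End.mul_apply, ← pow_succ, sub_mulVec, sub_mulVec,
        dotProduct_sub, dotProduct_sub] at this
      rw [← add_assoc]
      linarith
    refine (Finset.sum_le_sum fun i _ => hstep i).trans ?_
    rw [Finset.sum_range_sub' fun i => z ⬝ᵥ (L ^ (j + i)) P *ᵥ z]
    have := hnn hP z (j + φ k)
    simp only [add_zero]
    linarith
  -- Each `y i` has zero cost at every time, hence decays by `hdet`; summing over `i` contradicts
  -- `hone`.
  obtain ⟨y, hy⟩ := exists_sum_vecMulVec hVpsd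
  have hyQ : ∀ i j, y i ⬝ᵥ (L ^ j) Q *ᵥ y i = 0 := by
    intro i j
    have h0 := hzero j
    rw [hy] at h0
    have := (Finset.sum_eq_zero_iff_of_nonneg fun i _ => hnn hQ (y i) j).1
      (le_antisymm h0 (Finset.sum_nonneg fun i _ => hnn hQ (y i) j))
    exact this i (Finset.mem_univ i)
  have hmsz : ∀ i, Tendsto (fun k => y i ⬝ᵥ (L ^ k) 1 *ᵥ y i) atTop (𝓝 0) := fun i =>
    (meanSquareToZero_iff hw M N (y i)).1
      (hdet (y i) fun k => ae_mulVec_state_eq_zero hw hQ (hyQ i k))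
  have hfin : Tendsto (fun k => ∑ i, y i ⬝ᵥ (L ^ k) 1 *ᵥ y i) atTop (𝓝 0) := by
    simpa using tendsto_finsetSum Finset.univ fun i _ => hmsz i
  refine absurd (ge_of_tendsto' hfin fun k => ?_) (not_le.2 zero_lt_one)
  exact (hone k).trans_eq (hy _)

end Stability

/-! ### The Q-function matrix, completion of the square and the Riccati map. -/

section Riccati

variable {n m : ℕ} (A : Matrix (Fin n) (Fin n) ℝ) (B : Matrix (Fin n) (Fin m) ℝ)
  (C : Matrix (Fin n) (Fin n) ℝ) (D : Matrix (Fin n) (Fin m) ℝ)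
  (Q : Matrix (Fin n) (Fin n) ℝ) (R : Matrix (Fin m) (Fin m) ℝ)

theorem compress_fromBlocks (X₁₁ : Matrix (Fin n) (Fin n) ℝ) (X₁₂ : Matrix (Fin n) (Fin m) ℝ)
    (X₂₁ : Matrix (Fin m) (Fin n) ℝ) (X₂₂ : Matrix (Fin m) (Fin m) ℝ)
    (F : Matrix (Fin m) (Fin n) ℝ) :
    compress (fromBlocks X₁₁ X₁₂ X₂₁ X₂₂) F =
      X₁₁ + X₁₂ * F + Fᵀ * X₂₁ + Fᵀ * X₂₂ * F := by
  rw [compress, transpose_fromRows, fromCols_mul_fromBlocks, fromCols_mul_fromRows]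
  simp only [transpose_one, Matrix.one_mul, Matrix.mul_one, Matrix.add_mul]
  abel

theorem compress_qMatrix_eq_lyapunov (P : Matrix (Fin n) (Fin n) ℝ)
    (F : Matrix (Fin m) (Fin n) ℝ) :
    compress (qMatrix A B C D Q R P) F =
      lyapunov (A + B * F) (C + D * F) P + (Q + Fᵀ * R * F) := by
  rw [qMatrix, compress_fromBlocks, lyapunov_apply]
  simp only [transpose_add, transpose_mul, Matrix.add_mul, Matrix.mul_add, Matrix.mul_assoc]
  abel

theorem evaluation_iff (P : Matrix (Fin n) (Fin n) ℝ) (F : Matrix (Fin m) (Fin n) ℝ) :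
    P = (A + B * F)ᵀ * P * (A + B * F) + (C + D * F)ᵀ * P * (C + D * F) + Q + Fᵀ * R * F ↔
      P = compress (qMatrix A B C D Q R P) F := by
  rw [compress_qMatrix_eq_lyapunov, lyapunov_apply, add_assoc _ Q]

theorem add_quadratic_eq (W : Matrix (Fin m) (Fin m) ℝ) (hW : W.PosDef)
    (K F : Matrix (Fin m) (Fin n) ℝ) :
    Kᵀ * F + Fᵀ * K + Fᵀ * W * F =
      -(Kᵀ * W⁻¹ * K) + (F - -(W⁻¹ * K))ᵀ * W * (F - -(W⁻¹ * K)) := by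
  have hdet : IsUnit W.det := hW.det_pos.ne'.isUnit
  have hsymm : Wᵀ = W := by
    simpa [conjTranspose_eq_transpose_of_trivial] using hW.isHermitian.eq
  simp only [sub_neg_eq_add, transpose_add, transpose_mul, transpose_nonsing_inv, hsymm,
    Matrix.add_mul, Matrix.mul_add, Matrix.mul_assoc, mul_nonsing_inv_cancel_left _ _ hdet,
    nonsing_inv_mul_cancel_left _ _ hdet]
  abel

/-- The right-hand side of the generalized algebraic Riccati equation. -/
noncomputable def riccati (P : Matrix (Fin n) (Fin n) ℝ) : Matrix (Fin n) (Fin n) ℝ :=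
  Aᵀ * P * A + Cᵀ * P * C + Q
    - (Aᵀ * P * B + Cᵀ * P * D) * (R + Bᵀ * P * B + Dᵀ * P * D)⁻¹
      * (Bᵀ * P * A + Dᵀ * P * C)

-- Makes the inverse in the gain and in the Riccati map a true inverse at every semidefinite `P`.
variable {R} in
theorem inputWeight_posDef (hR : R.PosDef) {P : Matrix (Fin n) (Fin n) ℝ} (hP : P.PosSemidef) :
    (R + Bᵀ * P * B + Dᵀ * P * D).PosDef :=
  (hR.add_posSemidef (PosSemidef.transpose_mul_mul hP B)).add_posSemidef
    (PosSemidef.transpose_mul_mul hP D)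

variable {R} in
/-- Completion of the square in the gain. -/
theorem compress_qMatrix_eq_riccati (hR : R.PosDef) {P : Matrix (Fin n) (Fin n) ℝ}
    (hP : P.PosSemidef) (F : Matrix (Fin m) (Fin n) ℝ) :
    compress (qMatrix A B C D Q R P) F = riccati A B C D Q R P +
      (F - gain A B C D R P)ᵀ * (R + Bᵀ * P * B + Dᵀ * P * D) * (F - gain A B C D R P) := by
  have hsymm := (posSemidef_iff_real.1 hP).1
  have hK : (Bᵀ * P * A + Dᵀ * P * C)ᵀ = Aᵀ * P * B + Cᵀ * P * D := by
    simp [hsymm, Matrix.mul_assoc]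
  have := add_quadratic_eq _ (inputWeight_posDef B D hR hP) (Bᵀ * P * A + Dᵀ * P * C) F
  rw [hK] at this
  rw [qMatrix, compress_fromBlocks, gain, riccati, sub_eq_add_neg, add_assoc _ (-_), ← this]
  abel

variable {R} in
theorem compress_qMatrix_gain (hR : R.PosDef) {P : Matrix (Fin n) (Fin n) ℝ}
    (hP : P.PosSemidef) :
    compress (qMatrix A B C D Q R P) (gain A B C D R P) = riccati A B C D Q R P := by
  simp [compress_qMatrix_eq_riccati A B C D Q hR hP]

variable {R} in
theorem compress_qMatrix_sub_riccati (hR : R.PosDef) {P : Matrix (Fin n) (Fin n) ℝ}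
    (hP : P.PosSemidef) (F : Matrix (Fin m) (Fin n) ℝ) :
    (compress (qMatrix A B C D Q R P) F - riccati A B C D Q R P).PosSemidef := by
  rw [compress_qMatrix_eq_riccati A B C D Q hR hP, add_sub_cancel_left]
  exact PosSemidef.transpose_mul_mul (inputWeight_posDef B D hR hP).posSemidef _

theorem stageCost_posSemidef {Q : Matrix (Fin n) (Fin n) ℝ} {R : Matrix (Fin m) (Fin m) ℝ}
    (hQ : Q.PosSemidef) (hR : R.PosDef) (F : Matrix (Fin m) (Fin n) ℝ) :
    (Q + Fᵀ * R * F).PosSemidef :=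
  hQ.add (PosSemidef.transpose_mul_mul hR.posSemidef F)

theorem continuousAt_inv_of_det_ne_zero {W : Matrix (Fin m) (Fin m) ℝ} (hW : W.det ≠ 0) :
    ContinuousAt (fun X : Matrix (Fin m) (Fin m) ℝ => X⁻¹) W := by
  simp_rw [inv_def, Ring.inverse_eq_inv']
  exact ((continuous_id.matrix_det.continuousAt).inv₀ hW).smul
    continuous_id.matrix_adjugate.continuousAt

variable {R} in
theorem continuousAt_gain (hR : R.PosDef) {P : Matrix (Fin n) (Fin n) ℝ} (hP : P.PosSemidef) :
    ContinuousAt (gain A B C D R) P := by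
  have h1 : Continuous fun P : Matrix (Fin n) (Fin n) ℝ => R + Bᵀ * P * B + Dᵀ * P * D := by
    fun_prop
  have h2 : Continuous fun P : Matrix (Fin n) (Fin n) ℝ => Bᵀ * P * A + Dᵀ * P * C := by
    fun_prop
  have h3 := (continuousAt_inv_of_det_ne_zero (inputWeight_posDef B D hR hP).det_pos.ne').comp
    (f := fun P : Matrix (Fin n) (Fin n) ℝ => R + Bᵀ * P * B + Dᵀ * P * D) h1.continuousAt
  exact ((continuous_fst.matrix_mul continuous_snd).continuousAt.comp
    (h3.prodMk h2.continuousAt)).neg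

theorem continuous_qMatrix : Continuous (qMatrix A B C D Q R) := by
  unfold qMatrix
  fun_prop

/-- The quadratic forms decrease and are bounded below; polarization recovers the entries from them.
-/
theorem exists_tendsto_of_antitone {f : ℕ → Matrix (Fin n) (Fin n) ℝ}
    (h0 : ∀ k, (f k).PosSemidef) (h : ∀ k, (f k - f (k + 1)).PosSemidef) :
    ∃ P, Tendsto f atTop (𝓝 P) := by
  have hq : ∀ x, ∃ c, Tendsto (fun k => x ⬝ᵥ f k *ᵥ x) atTop (𝓝 c) := by
    intro x
    refine ⟨_, tendsto_atTop_ciInf (antitone_nat_of_succ_le fun k => ?_) ⟨0, ?_⟩⟩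
    · have := (posSemidef_iff_real.1 (h k)).2 x
      rw [sub_mulVec, dotProduct_sub] at this
      linarith
    · rintro _ ⟨k, rfl⟩
      exact (posSemidef_iff_real.1 (h0 k)).2 x
  choose c hc using hq
  have he : ∀ i j k, f k i j = ((Pi.single i 1 + Pi.single j 1) ⬝ᵥ
      f k *ᵥ (Pi.single i 1 + Pi.single j 1) - Pi.single i 1 ⬝ᵥ f k *ᵥ Pi.single i 1
      - Pi.single j 1 ⬝ᵥ f k *ᵥ Pi.single j 1) / 2 := by
    intro i j k
    have hij : f k j i = f k i j := congrFun (congrFun (posSemidef_iff_real.1 (h0 k)).1 i) j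
    simp [mulVec_add, add_dotProduct, dotProduct_add, hij]
    ring
  refine ⟨fun i j => (c (Pi.single i 1 + Pi.single j 1) - c (Pi.single i 1)
    - c (Pi.single j 1)) / 2, tendsto_pi_nhds.2 fun i => tendsto_pi_nhds.2 fun j => ?_⟩
  simp_rw [he i j]
  exact (((hc _).sub (hc _)).sub (hc _)).div_const 2

/-- The dual update at `F` is the policy evaluation at `F`. -/
theorem dual_iff (X : Matrix (Fin n ⊕ Fin m) (Fin n ⊕ Fin m) ℝ) (F : Matrix (Fin m) (Fin n) ℝ) :
    (augmented A B F)ᵀ * X * augmented A B F + (augmented C D F)ᵀ * X * augmented C D F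
      + weight Q R = X ↔ X = qMatrix A B C D Q R (compress X F) := by
  -- Because `A_F = [I; F][A B]`, the dual update sees `X` only through `compress X F`.
  have hfac : ∀ (A : Matrix (Fin n) (Fin n) ℝ) (B : Matrix (Fin n) (Fin m) ℝ),
      augmented A B F = fromRows (1 : Matrix (Fin n) (Fin n) ℝ) F * fromCols A B := by
    intro A B
    rw [augmented, fromRows_mul_fromCols]
    simp
  have hq : ∀ (A : Matrix (Fin n) (Fin n) ℝ) (B : Matrix (Fin n) (Fin m) ℝ),
      (augmented A B F)ᵀ * X * augmented A B F = fromBlocks (Aᵀ * compress X F * A)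
        (Aᵀ * compress X F * B) (Bᵀ * compress X F * A) (Bᵀ * compress X F * B) := by
    intro A B
    rw [← fromRows_mul_fromCols, ← fromRows_mul, ← transpose_fromCols, hfac, compress,
      transpose_mul]
    simp only [Matrix.mul_assoc]
  rw [hq, hq, weight, fromBlocks_add, fromBlocks_add, qMatrix, eq_comm]
  simp only [add_zero]
  have e1 : ∀ U V : Matrix (Fin n) (Fin n) ℝ, U + V + Q = Q + U + V := fun U V => by abel
  have e2 : ∀ U V : Matrix (Fin m) (Fin m) ℝ, U + V + R = R + U + V := fun U V => by abel
  rw [e1, e2]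

theorem primal_eq_gain {P : Matrix (Fin n) (Fin n) ℝ} (hP : Pᵀ = P) :
    -((qMatrix A B C D Q R P).toBlocks₂₂⁻¹ * (qMatrix A B C D Q R P).toBlocks₁₂ᵀ) =
      gain A B C D R P := by
  simp [qMatrix, gain, hP, Matrix.mul_assoc]

end Riccati

/-! ### Stabilizing gains, policy improvement and uniqueness for the Riccati equation. -/

section PolicyIteration

variable {Ω : Type*} [MeasurableSpace Ω] {μ : Measure Ω} [IsProbabilityMeasure μ]
  {w : ℕ → Ω → ℝ} {n m : ℕ} {A : Matrix (Fin n) (Fin n) ℝ} {B : Matrix (Fin n) (Fin m) ℝ}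
  {C : Matrix (Fin n) (Fin n) ℝ} {D : Matrix (Fin n) (Fin m) ℝ}
  {Q : Matrix (Fin n) (Fin n) ℝ} {R : Matrix (Fin m) (Fin m) ℝ}

theorem mulVec_eq_zero_of_posSemidef {S : Matrix (Fin n) (Fin n) ℝ} (hS : S.PosSemidef)
    {x : Fin n → ℝ} (h : x ⬝ᵥ S *ᵥ x = 0) : S *ᵥ x = 0 :=
  (hS.dotProduct_mulVec_zero_iff x).1 (by simpa using h)

theorem mulVec_eq_zero_of_stageCost (hQ : Q.PosSemidef) (hR : R.PosDef)
    {F : Matrix (Fin m) (Fin n) ℝ} {x : Fin n → ℝ} (h : x ⬝ᵥ (Q + Fᵀ * R * F) *ᵥ x = 0) :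
    Q *ᵥ x = 0 ∧ F *ᵥ x = 0 := by
  have hF : x ⬝ᵥ (Fᵀ * R * F) *ᵥ x = (F *ᵥ x) ⬝ᵥ R *ᵥ (F *ᵥ x) := by
    rw [← mulVec_mulVec, ← mulVec_mulVec, dotProduct_mulVec, vecMul_transpose]
  rw [add_mulVec, dotProduct_add, hF] at h
  have h1 := (posSemidef_iff_real.1 hQ).2 x
  have h2 := (posSemidef_iff_real.1 hR.posSemidef).2 (F *ᵥ x)
  refine ⟨mulVec_eq_zero_of_posSemidef hQ (by linarith), ?_⟩
  have h3 := mulVec_eq_zero_of_posSemidef hR.posSemidef (x := F *ᵥ x) (by linarith)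
  exact eq_zero_of_mulVec_eq_zero hR.det_pos.ne' h3

omit [IsProbabilityMeasure μ] in
/-- A closed-loop trajectory of zero cost is an open-loop trajectory. -/
theorem state_ae_eq_of_stageCost (hQ : Q.PosSemidef) (hR : R.PosDef)
    {F : Matrix (Fin m) (Fin n) ℝ} {z : Fin n → ℝ}
    (h : ∀ k, ∀ᵐ ω ∂μ, state w (A + B * F) (C + D * F) z k ω ⬝ᵥ (Q + Fᵀ * R * F) *ᵥ
      state w (A + B * F) (C + D * F) z k ω = 0) (k : ℕ) :
    ∀ᵐ ω ∂μ, state w (A + B * F) (C + D * F) z k ω = state w A C z k ω := by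
  induction k with
  | zero => exact ae_of_all _ fun ω => rfl
  | succ k ih =>
    filter_upwards [ih, h k] with ω h1 h2
    have h3 := (mulVec_eq_zero_of_stageCost hQ hR h2).2
    rw [h1] at h3
    simp only [state, h1, add_mulVec, ← mulVec_mulVec, h3, mulVec_zero, add_zero]

omit [IsProbabilityMeasure μ] in
theorem mulVec_state_ae_eq_zero_of_stageCost (hQ : Q.PosSemidef) (hR : R.PosDef)
    {F : Matrix (Fin m) (Fin n) ℝ} {z : Fin n → ℝ}
    (h : ∀ k, ∀ᵐ ω ∂μ, state w (A + B * F) (C + D * F) z k ω ⬝ᵥ (Q + Fᵀ * R * F) *ᵥ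
      state w (A + B * F) (C + D * F) z k ω = 0) (k : ℕ) :
    ∀ᵐ ω ∂μ, Q *ᵥ state w A C z k ω = 0 := by
  filter_upwards [state_ae_eq_of_stageCost hQ hR h k, h k] with ω h1 h2
  rw [← h1]
  exact (mulVec_eq_zero_of_stageCost hQ hR h2).1

omit [IsProbabilityMeasure μ] in
theorem ExactlyObservable.exactlyDetectable (h : ExactlyObservable μ w A C Q) :
    ExactlyDetectable μ w A C Q := by
  obtain ⟨T, hT, h⟩ := h
  refine ⟨T, hT, fun z hz => ?_⟩
  obtain rfl := h z hz
  have h0 : ∀ k ω, state w A C 0 k ω = 0 := by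
    intro k ω
    induction k with
    | zero => rfl
    | succ k ih => simp [state, ih]
  simp [MeanSquareToZero, h0]

/-- Zero-cost closed-loop trajectories agree almost surely with open-loop ones annihilated by `Q`,
so detectability of `(A, C | Q)` supplies the hypothesis of `asms_of_supersolution`. -/
theorem mem_stabilizingGains_of_supersolution (hw : IsNoise μ w) (hQ : Q.PosSemidef)
    (hR : R.PosDef) (hdet : ExactlyDetectable μ w A C Q) {P : Matrix (Fin n) (Fin n) ℝ}
    (hP : P.PosSemidef) {F : Matrix (Fin m) (Fin n) ℝ}
    (h : (P - compress (qMatrix A B C D Q R P) F).PosSemidef) :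
    F ∈ stabilizingGains μ w A B C D := by
  rw [compress_qMatrix_eq_lyapunov, ← sub_sub] at h
  refine asms_of_supersolution hw hP (stageCost_posSemidef hQ hR F) h fun z hz => ?_
  obtain ⟨T, -, hT⟩ := hdet
  have := hT z fun k _ => mulVec_state_ae_eq_zero_of_stageCost hQ hR hz k
  refine this.congr fun k => integral_congr_ae ?_
  filter_upwards [state_ae_eq_of_stageCost hQ hR hz k] with ω hω
  rw [hω]

theorem exists_evaluation (hw : IsNoise μ w) {F : Matrix (Fin m) (Fin n) ℝ}
    (hF : F ∈ stabilizingGains μ w A B C D) (Q : Matrix (Fin n) (Fin n) ℝ)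
    (R : Matrix (Fin m) (Fin m) ℝ) : ∃ P, P = compress (qMatrix A B C D Q R P) F := by
  simp_rw [compress_qMatrix_eq_lyapunov]
  exact ASMS.exists_lyapunov_eq hw hF _

theorem evaluation_unique (hw : IsNoise μ w) {F : Matrix (Fin m) (Fin n) ℝ}
    (hF : F ∈ stabilizingGains μ w A B C D) {P P' : Matrix (Fin n) (Fin n) ℝ}
    (hP : P = compress (qMatrix A B C D Q R P) F)
    (hP' : P' = compress (qMatrix A B C D Q R P') F) : P = P' := by
  rw [compress_qMatrix_eq_lyapunov] at hP hP'
  exact ASMS.lyapunov_eq_unique hw hF hP hP'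

theorem evaluation_posSemidef (hw : IsNoise μ w) (hQ : Q.PosSemidef) (hR : R.PosDef)
    {F : Matrix (Fin m) (Fin n) ℝ} (hF : F ∈ stabilizingGains μ w A B C D)
    {P : Matrix (Fin n) (Fin n) ℝ} (hP : P = compress (qMatrix A B C D Q R P) F) :
    P.PosSemidef := by
  refine ASMS.posSemidef_of_sub_lyapunov hw hF ?_
  rw [compress_qMatrix_eq_lyapunov, ← sub_eq_iff_eq_add'] at hP
  rw [hP]
  exact stageCost_posSemidef hQ hR F

/-- The new gain minimizes `compress (qMatrix P)`, whose value at `F` is `P`; so `P` is a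
supersolution for it. -/
theorem gain_mem_stabilizingGains (hw : IsNoise μ w) (hQ : Q.PosSemidef) (hR : R.PosDef)
    (hdet : ExactlyDetectable μ w A C Q) {F : Matrix (Fin m) (Fin n) ℝ}
    {P : Matrix (Fin n) (Fin n) ℝ} (hPpsd : P.PosSemidef)
    (hP : P = compress (qMatrix A B C D Q R P) F) :
    gain A B C D R P ∈ stabilizingGains μ w A B C D := by
  refine mem_stabilizingGains_of_supersolution hw hQ hR hdet hPpsd ?_
  rw [compress_qMatrix_gain A B C D Q hR hPpsd]
  have := compress_qMatrix_sub_riccati A B C D Q hR hPpsd F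
  rwa [← hP] at this

/-- Comparison of a supersolution of the policy evaluation with its solution. -/
theorem sub_posSemidef_of_evaluation (hw : IsNoise μ w)
    {F : Matrix (Fin m) (Fin n) ℝ} (hF : F ∈ stabilizingGains μ w A B C D)
    {P P' : Matrix (Fin n) (Fin n) ℝ}
    (h : ((P - compress (qMatrix A B C D Q R P) F) -
      (P' - compress (qMatrix A B C D Q R P') F)).PosSemidef) :
    (P - P').PosSemidef := by
  refine ASMS.posSemidef_of_sub_lyapunov hw hF ?_
  convert h using 1
  rw [compress_qMatrix_eq_lyapunov, compress_qMatrix_eq_lyapunov, map_sub]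
  abel

theorem policy_improvement (hw : IsNoise μ w) (hR : R.PosDef)
    {F : Matrix (Fin m) (Fin n) ℝ} {P P' : Matrix (Fin n) (Fin n) ℝ} (hPpsd : P.PosSemidef)
    (hP : P = compress (qMatrix A B C D Q R P) F)
    (hF : gain A B C D R P ∈ stabilizingGains μ w A B C D)
    (hP' : P' = compress (qMatrix A B C D Q R P') (gain A B C D R P)) :
    (P - P').PosSemidef := by
  refine sub_posSemidef_of_evaluation (Q := Q) (R := R) hw hF ?_
  rw [← hP', sub_self, sub_zero, compress_qMatrix_gain A B C D Q hR hPpsd]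
  have := compress_qMatrix_sub_riccati A B C D Q hR hPpsd F
  rwa [← hP] at this

/-- The gain of `P'` is stabilizing and has value `P'`, while `P` is a subsolution for it by
minimality. Exchanging the roles of `P` and `P'` gives uniqueness. -/
theorem riccati_sub_posSemidef (hw : IsNoise μ w) (hQ : Q.PosSemidef) (hR : R.PosDef)
    (hdet : ExactlyDetectable μ w A C Q) {P P' : Matrix (Fin n) (Fin n) ℝ}
    (hPpsd : P.PosSemidef) (hP : riccati A B C D Q R P = P)
    (hPpsd' : P'.PosSemidef) (hP' : riccati A B C D Q R P' = P') : (P' - P).PosSemidef := by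
  have he : P' = compress (qMatrix A B C D Q R P') (gain A B C D R P') := by
    rw [compress_qMatrix_gain A B C D Q hR hPpsd', hP']
  refine sub_posSemidef_of_evaluation (Q := Q) (R := R) hw
    (gain_mem_stabilizingGains hw hQ hR hdet hPpsd' he) ?_
  rw [← he, sub_self, zero_sub, neg_sub]
  have := compress_qMatrix_sub_riccati A B C D Q hR hPpsd (gain A B C D R P')
  rwa [hP] at this

theorem riccati_unique (hw : IsNoise μ w) (hQ : Q.PosSemidef) (hR : R.PosDef)
    (hdet : ExactlyDetectable μ w A C Q) {P P' : Matrix (Fin n) (Fin n) ℝ}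
    (hPpsd : P.PosSemidef) (hP : riccati A B C D Q R P = P)
    (hPpsd' : P'.PosSemidef) (hP' : riccati A B C D Q R P' = P') : P = P' := by
  open scoped MatrixOrder ComplexOrder in
  exact le_antisymm (le_iff.2 (riccati_sub_posSemidef hw hQ hR hdet hPpsd hP hPpsd' hP'))
    (le_iff.2 (riccati_sub_posSemidef hw hQ hR hdet hPpsd' hP' hPpsd hP))

/-- If `z'Pz = 0`, then by nonnegativity all stage costs from `z` under the optimal gain vanish, so
`z` is unobservable. -/
theorem riccati_posDef (hw : IsNoise μ w) (hQ : Q.PosSemidef) (hR : R.PosDef)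
    (hobs : ExactlyObservable μ w A C Q) {P : Matrix (Fin n) (Fin n) ℝ}
    (hPpsd : P.PosSemidef) (hP : riccati A B C D Q R P = P) : P.PosDef := by
  obtain ⟨T, -, hT⟩ := hobs
  set F := gain A B C D R P
  have he : P = compress (qMatrix A B C D Q R P) F := by
    rw [compress_qMatrix_gain A B C D Q hR hPpsd, hP]
  rw [compress_qMatrix_eq_lyapunov] at he
  set L := lyapunov (A + B * F) (C + D * F)
  have hS := stageCost_posSemidef hQ hR F
  refine .of_dotProduct_mulVec_pos hPpsd.isHermitian fun z hz => ?_
  refine lt_of_le_of_ne (hPpsd.dotProduct_mulVec_nonneg z) fun h0 => hz (hT z fun k _ => ?_)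
  simp only [star_trivial] at h0
  refine mulVec_state_ae_eq_zero_of_stageCost (F := F) (B := B) (D := D) hQ hR (fun k => ?_) k
  refine ae_mulVec_state_eq_zero hw hS ?_
  have hdec : ∀ k, z ⬝ᵥ (L ^ k) P *ᵥ z =
      z ⬝ᵥ (L ^ (k + 1)) P *ᵥ z + z ⬝ᵥ (L ^ k) (Q + Fᵀ * R * F) *ᵥ z := by
    intro k
    conv_lhs => rw [he]
    rw [map_add, ← Module.End.mul_apply, ← pow_succ, add_mulVec, dotProduct_add]
  have h1 : ∀ k, 0 ≤ z ⬝ᵥ (L ^ k) P *ᵥ z := fun k =>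
    (posSemidef_iff_real.1 (lyapunov_pow_posSemidef _ _ hPpsd k)).2 z
  have h2 : ∀ k, 0 ≤ z ⬝ᵥ (L ^ k) (Q + Fᵀ * R * F) *ᵥ z := fun k =>
    (posSemidef_iff_real.1 (lyapunov_pow_posSemidef _ _ hS k)).2 z
  have h3 : ∀ k, z ⬝ᵥ (L ^ k) P *ᵥ z = 0 := by
    intro k
    induction k with
    | zero => simpa using h0.symm
    | succ k ih => linarith [hdec k, h1 (k + 1), h2 k]
  linarith [hdec k, h3 k, h3 (k + 1)]

end PolicyIteration

/-! ### The two iterations, their equivalence and convergence. -/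

section Algorithm

variable {Ω : Type*} [MeasurableSpace Ω] {μ : Measure Ω} [IsProbabilityMeasure μ]
  {w : ℕ → Ω → ℝ} {n m : ℕ} {A : Matrix (Fin n) (Fin n) ℝ} {B : Matrix (Fin n) (Fin m) ℝ}
  {C : Matrix (Fin n) (Fin n) ℝ} {D : Matrix (Fin n) (Fin m) ℝ}
  {Q : Matrix (Fin n) (Fin n) ℝ} {R : Matrix (Fin m) (Fin m) ℝ}
  {F₀ : Matrix (Fin m) (Fin n) ℝ} {P : ℕ → Matrix (Fin n) (Fin n) ℝ}
  {F : ℕ → Matrix (Fin m) (Fin n) ℝ} {X : ℕ → Matrix (Fin n ⊕ Fin m) (Fin n ⊕ Fin m) ℝ}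

theorem qMatrix_posSemidef (hQ : Q.PosSemidef) (hR : R.PosDef) {P : Matrix (Fin n) (Fin n) ℝ}
    (hP : P.PosSemidef) : (qMatrix A B C D Q R P).PosSemidef := by
  have h : qMatrix A B C D Q R P =
      (fromCols A B)ᴴ * P * fromCols A B + (fromCols C D)ᴴ * P * fromCols C D
      + (fromCols (1 : Matrix (Fin n) (Fin n) ℝ) (0 : Matrix (Fin n) (Fin m) ℝ))ᴴ * Q
        * fromCols (1 : Matrix (Fin n) (Fin n) ℝ) (0 : Matrix (Fin n) (Fin m) ℝ)
      + (fromCols (0 : Matrix (Fin m) (Fin n) ℝ) (1 : Matrix (Fin m) (Fin m) ℝ))ᴴ * R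
        * fromCols (0 : Matrix (Fin m) (Fin n) ℝ) (1 : Matrix (Fin m) (Fin m) ℝ) := by
    have hq : ∀ {k : ℕ} (S : Matrix (Fin k) (Fin k) ℝ) (U : Matrix (Fin k) (Fin n) ℝ)
        (V : Matrix (Fin k) (Fin m) ℝ), (fromCols U V)ᴴ * S * fromCols U V =
          fromBlocks (Uᵀ * S * U) (Uᵀ * S * V) (Vᵀ * S * U) (Vᵀ * S * V) := by
      intro k S U V
      rw [conjTranspose_eq_transpose_of_trivial, transpose_fromCols, fromRows_mul,
        fromRows_mul_fromCols]
    simp only [hq, fromBlocks_add, qMatrix, transpose_one, transpose_zero, Matrix.one_mul,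
      Matrix.zero_mul, Matrix.mul_one, Matrix.mul_zero, add_zero]
    congr 1 <;> abel
  rw [h]
  exact (((hP.conjTranspose_mul_mul_same _).add (hP.conjTranspose_mul_mul_same _)).add
    (hQ.conjTranspose_mul_mul_same _)).add (hR.posSemidef.conjTranspose_mul_mul_same _)

theorem IsPolicyIteration.eq_compress (h : IsPolicyIteration A B C D Q R F₀ P F) (i : ℕ) :
    P i = compress (qMatrix A B C D Q R (P i)) (F i) :=
  (evaluation_iff A B C D Q R (P i) (F i)).1 (h.evaluation i)

theorem IsPolicyIteration.mem_stabilizingGains (hw : IsNoise μ w) (hQ : Q.PosSemidef)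
    (hR : R.PosDef) (hdet : ExactlyDetectable μ w A C Q)
    (h₀ : F₀ ∈ stabilizingGains μ w A B C D) (h : IsPolicyIteration A B C D Q R F₀ P F) (i : ℕ) :
    F i ∈ stabilizingGains μ w A B C D := by
  induction i with
  | zero => rwa [h.init]
  | succ i ih =>
    rw [h.improvement]
    exact gain_mem_stabilizingGains hw hQ hR hdet
      (evaluation_posSemidef hw hQ hR ih (h.eq_compress i)) (h.eq_compress i)

theorem IsPolicyIteration.posSemidef (hw : IsNoise μ w) (hQ : Q.PosSemidef)
    (hR : R.PosDef) (hdet : ExactlyDetectable μ w A C Q)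
    (h₀ : F₀ ∈ stabilizingGains μ w A B C D) (h : IsPolicyIteration A B C D Q R F₀ P F) (i : ℕ) :
    (P i).PosSemidef :=
  evaluation_posSemidef hw hQ hR (h.mem_stabilizingGains hw hQ hR hdet h₀ i) (h.eq_compress i)

theorem exists_isPolicyIteration (hw : IsNoise μ w) (hQ : Q.PosSemidef)
    (hR : R.PosDef) (hdet : ExactlyDetectable μ w A C Q)
    (h₀ : F₀ ∈ stabilizingGains μ w A B C D) :
    ∃ P F, IsPolicyIteration A B C D Q R F₀ P F := by
  have hex : ∀ F : stabilizingGains μ w A B C D,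
      ∃ P, P = compress (qMatrix A B C D Q R P) F.1 := fun F => exists_evaluation hw F.2 Q R
  choose sol hsol using hex
  let step : stabilizingGains μ w A B C D → stabilizingGains μ w A B C D := fun F =>
    ⟨gain A B C D R (sol F), gain_mem_stabilizingGains hw hQ hR hdet
      (evaluation_posSemidef hw hQ hR F.2 (hsol F)) (hsol F)⟩
  refine ⟨fun i => sol (step^[i] ⟨F₀, h₀⟩), fun i => (step^[i] ⟨F₀, h₀⟩).1, rfl, fun i => ?_,
    fun i => ?_⟩
  · exact (evaluation_iff A B C D Q R _ _).2 (hsol _)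
  · rw [Function.iterate_succ_apply']

theorem IsPolicyIteration.unique (hw : IsNoise μ w) (hQ : Q.PosSemidef)
    (hR : R.PosDef) (hdet : ExactlyDetectable μ w A C Q)
    (h₀ : F₀ ∈ stabilizingGains μ w A B C D) (h : IsPolicyIteration A B C D Q R F₀ P F)
    {P' : ℕ → Matrix (Fin n) (Fin n) ℝ} {F' : ℕ → Matrix (Fin m) (Fin n) ℝ}
    (h' : IsPolicyIteration A B C D Q R F₀ P' F') : P' = P ∧ F' = F := by
  have hP : ∀ i, F' i = F i → P' i = P i := fun i hi => by
    have e := h'.eq_compress i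
    rw [hi] at e
    exact evaluation_unique hw (h.mem_stabilizingGains hw hQ hR hdet h₀ i) e (h.eq_compress i)
  have hF : ∀ i, F' i = F i := by
    intro i
    induction i with
    | zero => rw [h.init, h'.init]
    | succ i ih => rw [h.improvement, h'.improvement, hP i ih]
  exact ⟨funext fun i => hP i (hF i), funext hF⟩

theorem IsPolicyIteration.isPrimalDual (hw : IsNoise μ w) (hQ : Q.PosSemidef)
    (hR : R.PosDef) (hdet : ExactlyDetectable μ w A C Q)
    (h₀ : F₀ ∈ stabilizingGains μ w A B C D) (h : IsPolicyIteration A B C D Q R F₀ P F) :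
    IsPrimalDual A B C D Q R F₀ (fun i => qMatrix A B C D Q R (P i)) F where
  init := h.init
  dual i := by
    rw [dual_iff, ← h.eq_compress]
  primal i := by
    rw [primal_eq_gain A B C D Q R
      (posSemidef_iff_real.1 (h.posSemidef hw hQ hR hdet h₀ i)).1, h.improvement]

theorem IsPrimalDual.eq_qMatrix (h : IsPrimalDual A B C D Q R F₀ X F) (i : ℕ) :
    X i = qMatrix A B C D Q R (compress (X i) (F i)) :=
  (dual_iff A B C D Q R (X i) (F i)).1 (h.dual i)

theorem IsPrimalDual.isPolicyIteration (hw : IsNoise μ w) (hQ : Q.PosSemidef)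
    (hR : R.PosDef) (hdet : ExactlyDetectable μ w A C Q)
    (h₀ : F₀ ∈ stabilizingGains μ w A B C D) (h : IsPrimalDual A B C D Q R F₀ X F) :
    IsPolicyIteration A B C D Q R F₀ (fun i => compress (X i) (F i)) F := by
  have heq : ∀ i, compress (X i) (F i) =
      compress (qMatrix A B C D Q R (compress (X i) (F i))) (F i) := fun i => by
    rw [← h.eq_qMatrix]
  -- Symmetry of `X i` is not assumed; it follows from stability of `F i`, and the transpose in the
  -- primal update needs it. Hence the conditional form, discharged by the induction `hmem`.
  have himp : ∀ i, F i ∈ stabilizingGains μ w A B C D →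
      F (i + 1) = gain A B C D R (compress (X i) (F i)) := fun i hi => by
    have hp := evaluation_posSemidef hw hQ hR hi (heq i)
    rw [h.primal, ← primal_eq_gain A B C D Q R (posSemidef_iff_real.1 hp).1, ← h.eq_qMatrix]
  have hmem : ∀ i, F i ∈ stabilizingGains μ w A B C D := by
    intro i
    induction i with
    | zero => rwa [h.init]
    | succ i ih =>
      rw [himp i ih]
      exact gain_mem_stabilizingGains hw hQ hR hdet
        (evaluation_posSemidef hw hQ hR ih (heq i)) (heq i)
  exact ⟨h.init, fun i => (evaluation_iff A B C D Q R _ _).2 (heq i), fun i => himp i (hmem i)⟩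

/-- Policy iteration converges to a positive semidefinite solution of the Riccati equation. -/
theorem IsPolicyIteration.exists_tendsto (hw : IsNoise μ w) (hQ : Q.PosSemidef)
    (hR : R.PosDef) (hdet : ExactlyDetectable μ w A C Q)
    (h₀ : F₀ ∈ stabilizingGains μ w A B C D) (h : IsPolicyIteration A B C D Q R F₀ P F) :
    ∃ P₁, P₁.PosSemidef ∧ riccati A B C D Q R P₁ = P₁ ∧ Tendsto P atTop (𝓝 P₁) := by
  have hmem := h.mem_stabilizingGains hw hQ hR hdet h₀
  have hpsd := h.posSemidef hw hQ hR hdet h₀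
  obtain ⟨P₁, hlim⟩ := exists_tendsto_of_antitone hpsd fun i => by
    have hs := h.eq_compress (i + 1)
    have hm := hmem (i + 1)
    rw [h.improvement] at hs hm
    exact policy_improvement hw hR (hpsd i) (h.eq_compress i) hm hs
  have hP₁ := posSemidef_of_tendsto hlim hpsd
  refine ⟨P₁, hP₁, ?_, hlim⟩
  -- Limit in `P (i+1) = compress (qMatrix (P (i+1))) (gain (P i))`: the right side tends to the
  -- Riccati map at `P₁`.
  have hgain := (continuousAt_gain A B C D hR hP₁).tendsto.comp hlim
  have hlim' : Tendsto (fun i => P (i + 1)) atTop (𝓝 P₁) := (tendsto_add_atTop_iff_nat 1).2 hlim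
  have hX := ((continuous_qMatrix A B C D Q R).tendsto P₁).comp hlim'
  have hcont : Continuous fun p : Matrix (Fin n ⊕ Fin m) (Fin n ⊕ Fin m) ℝ ×
      Matrix (Fin m) (Fin n) ℝ => compress p.1 p.2 := by
    unfold compress
    have hrows : Continuous fun p : Matrix (Fin n ⊕ Fin m) (Fin n ⊕ Fin m) ℝ ×
        Matrix (Fin m) (Fin n) ℝ => fromRows (1 : Matrix (Fin n) (Fin n) ℝ) p.2 := by
      refine continuous_pi fun i => continuous_pi fun j => ?_
      cases i with
      | inl i => exact continuous_const
      | inr i => exact (continuous_apply_apply i j).comp continuous_snd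
    exact (hrows.matrix_transpose.matrix_mul continuous_fst).matrix_mul hrows
  have hc := (hcont.tendsto _).comp (hX.prodMk_nhds hgain)
  rw [compress_qMatrix_gain A B C D Q hR hP₁] at hc
  refine tendsto_nhds_unique (hc.congr fun i => ?_) hlim'
  have := h.eq_compress (i + 1)
  rw [h.improvement] at this
  exact this.symm

end Algorithm

end SLQR

/-! ### The main theorem. -/

theorem mainTheorem2 {Ω : Type*} [MeasurableSpace Ω] (μ : Measure Ω) [IsProbabilityMeasure μ]
    (w : ℕ → Ω → ℝ) (hw : SLQR.IsNoise μ w) {n m : ℕ}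
    (A : Matrix (Fin n) (Fin n) ℝ) (B : Matrix (Fin n) (Fin m) ℝ)
    (C : Matrix (Fin n) (Fin n) ℝ) (D : Matrix (Fin n) (Fin m) ℝ)
    (Q : Matrix (Fin n) (Fin n) ℝ) (R : Matrix (Fin m) (Fin m) ℝ)
    (hQ : Q.PosSemidef) (hR : R.PosDef)
    (hstab : SLQR.Stabilizable μ w A B C D)
    (hobs : SLQR.ExactlyObservable μ w A C Q ∨ SLQR.ExactlyDetectable μ w A C Q) :
    ∃ Pstar : Matrix (Fin n) (Fin n) ℝ,
      -- `P*` is the unique positive semidefinite solution of the Riccati equation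
      (Pstar.PosSemidef ∧ SLQR.SolvesGARE A B C D Q R Pstar ∧
        ∀ P : Matrix (Fin n) (Fin n) ℝ,
          P.PosSemidef → SLQR.SolvesGARE A B C D Q R P → P = Pstar) ∧
      (SLQR.ExactlyObservable μ w A C Q → Pstar.PosDef) ∧
      ∀ F₀ ∈ SLQR.stabilizingGains μ w A B C D,
        -- the algorithm is well defined
        (∃! XF : (ℕ → Matrix (Fin n ⊕ Fin m) (Fin n ⊕ Fin m) ℝ) × (ℕ → Matrix (Fin m) (Fin n) ℝ),
          SLQR.IsPrimalDual A B C D Q R F₀ XF.1 XF.2) ∧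
        ∀ (X : ℕ → Matrix (Fin n ⊕ Fin m) (Fin n ⊕ Fin m) ℝ) (F : ℕ → Matrix (Fin m) (Fin n) ℝ),
          SLQR.IsPrimalDual A B C D Q R F₀ X F →
            (∀ i, F i ∈ SLQR.stabilizingGains μ w A B C D ∧ (X i).PosSemidef ∧
              (X i).toBlocks₂₂.PosDef) ∧
            -- the algorithm coincides with the off-line policy iteration
            (∀ (P : ℕ → Matrix (Fin n) (Fin n) ℝ) (F' : ℕ → Matrix (Fin m) (Fin n) ℝ),
              SLQR.IsPolicyIteration A B C D Q R F₀ P F' ↔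
                F' = F ∧ P = fun i => SLQR.compress (X i) (F i)) ∧
            -- convergence
            Tendsto X atTop (𝓝 (SLQR.qMatrix A B C D Q R Pstar)) ∧
            Tendsto F atTop (𝓝 (SLQR.gain A B C D R Pstar)) := by
  have hdet : SLQR.ExactlyDetectable μ w A C Q :=
    hobs.elim SLQR.ExactlyObservable.exactlyDetectable id
  obtain ⟨G, hG⟩ := hstab
  obtain ⟨P₀, G₀, h₀⟩ := SLQR.exists_isPolicyIteration hw hQ hR hdet hG
  obtain ⟨Pstar, hpsd, hric, -⟩ := h₀.exists_tendsto hw hQ hR hdet hG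
  refine ⟨Pstar, ⟨hpsd, hric, fun P hP hPric =>
    SLQR.riccati_unique hw hQ hR hdet hP hPric hpsd hric⟩,
    fun ho => SLQR.riccati_posDef hw hQ hR ho hpsd hric, fun F₀ hF₀ => ⟨?_, fun X F hXF => ?_⟩⟩
  · obtain ⟨P, F, h⟩ := SLQR.exists_isPolicyIteration hw hQ hR hdet hF₀
    refine ⟨(fun i => SLQR.qMatrix A B C D Q R (P i), F), h.isPrimalDual hw hQ hR hdet hF₀, ?_⟩
    rintro ⟨X, F'⟩ hXF
    obtain ⟨hP, hF⟩ := h.unique hw hQ hR hdet hF₀ (hXF.isPolicyIteration hw hQ hR hdet hF₀)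
    refine Prod.ext (funext fun i => ?_) hF
    rw [← hP]
    exact hXF.eq_qMatrix i
  · have hpi := hXF.isPolicyIteration hw hQ hR hdet hF₀
    have hPi := hpi.posSemidef hw hQ hR hdet hF₀
    obtain ⟨P₁, hP₁, hric₁, hlim⟩ := hpi.exists_tendsto hw hQ hR hdet hF₀
    -- The limit for this `F₀` is the solution obtained from the gain `G`, so it does not depend on
    -- the initial gain.
    obtain rfl := SLQR.riccati_unique hw hQ hR hdet hP₁ hric₁ hpsd hric
    refine ⟨fun i => ⟨hpi.mem_stabilizingGains hw hQ hR hdet hF₀ i, ?_, ?_⟩,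
      fun P F' => ⟨fun h => ?_, ?_⟩, ?_, ?_⟩
    · rw [hXF.eq_qMatrix]
      exact SLQR.qMatrix_posSemidef hQ hR (hPi i)
    · rw [hXF.eq_qMatrix]
      exact SLQR.inputWeight_posDef B D hR (hPi i)
    · exact (hpi.unique hw hQ hR hdet hF₀ h).symm
    · rintro ⟨rfl, rfl⟩
      exact hpi
    · rw [funext hXF.eq_qMatrix]
      exact ((SLQR.continuous_qMatrix A B C D Q R).tendsto P₁).comp hlim
    -- Only the gains from index `1` on have the form `gain (P i)`; `F 0` is arbitrary.
    · refine (tendsto_add_atTop_iff_nat 1).1 ?_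
      rw [funext hpi.improvement]
      exact (SLQR.continuousAt_gain A B C D hR hP₁).tendsto.comp hlim
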